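/- Let $k$ be a commutative ring. A double algebra over $k$ is a $k$-module $A$ with two associative unital $k$-algebra structures $V=\langle A,\circ,e\rangle$ and $H=\langle A,\star,i\rangle$ such that, for all $a,b\in A$, \begin{align*} (a\star e)\circ b&=((a\star e)\circ i)\star b, & a\circ(b\star e)&=(i\circ(b\star e))\star a,\\ (a\circ i)\star b&=((a\circ i)\star e)\circ b, & a\star(b\circ i)&=(e\star(b\circ i))\circ a,\\ a\circ(e\star b)&=a\star(i\circ(e\star b)), & (e\star a)\circ b&=b\star((e\star a)\circ i),\\ a\star(i\circ b)&=a\circ(e\star(i\circ b)), & (i\circ a)\star b&=b\circ((i\circ a)\star e). \end{align*} Put $\varphi_L(a)=a\star e$, $\varphi_R(a)=e\star a$, $\varphi_B(a)=a\circ i$, $\varphi_T(a)=i\circ a$, and $X=\varphi_X(A)$ for $X\in\{L,R,B,T\}$; then $L,R$ are subalgebras of $V$ and $B,T$ are subalgebras of $H$. Write $A\otimes_X A$ for the tensor square of the $X$-bimodule $A$, formed in $V$ if $X\in\{L,R\}$ and in $H$ if $X\in\{B,T\}$ (a $k$-module). The double algebra is Frobenius if each $\varphi_X$ is a Frobenius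 homomorphism: an $X$-bimodule map $A\to X$ (in $V$ for $X=L,R$, in $H$ for $X=B,T$) for which there are finitely many pairs $(p_j,q_j)$ in $A$, called dual bases, with $\sum_j\varphi_X(a p_j)q_j=a=\sum_j p_j\varphi_X(q_j a)$ for all $a\in A$. The element $\sum_j p_j\otimes q_j\in A\otimes_X A$ does not depend on the choice. Denote it, with summation suppressed, by $x_j\otimes y_j$ for $\varphi_L$, $x^j\otimes y^j$ for $\varphi_R$, $u_k\otimes v_k$ for $\varphi_B$, $u^k\otimes v^k$ for $\varphi_T$. A Frobenius double algebra is distributive if for all $a,a',a''\in A$ \begin{align*} a\circ(a'\star a'')&=((a\star u_k)\circ a')\star(v_k\circ a''), & a\star(a'\circ a'')&=((a\circ x_j)\star a')\circ(y_j\star a''),\\ (a'\star a'')\circ a&=(a'\circ(a\star u^k))\star(a''\circ v^k), & (a'\circ a'')\star a&=(a'\star(a\circ x^j))\circ(a''\star y^j). \end{align*} Theorem. Let $A$ be a distributive Frobenius double algebra over $k$. Then: (1) $A$ has an antipode, that is, there is a $k$-linear map $S\colon A\to A$ such that for all $a,a',a''\in A$ \begin{align*} \varphi_B(a'\star(a''\circ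 a))&=\varphi_B((a'\circ S(a))\star a''), & \varphi_R(a'\circ(a\star a''))&=\varphi_R((S(a)\star a')\circ a''),\\ \varphi_L((a'\star a)\circ a'')&=\varphi_L(a'\circ(a''\star S(a))), & \varphi_T((a\circ a')\star a'')&=\varphi_T(a'\star(S(a)\circ a'')). \end{align*} (2) The eight (well-defined, $k$-linear) Galois maps $\Gamma_{XY}\colon A\otimes_X A\to A\otimes_Y A$ given by \begin{align*} \Gamma_{RB}(a\otimes a')&=a\star u_k\otimes v_k\circ a', & \Gamma_{BR}(a\otimes a')&=a\star x^j\otimes y^j\circ a',\\ \Gamma_{LT}(a\otimes a')&=a\circ u^k\otimes v^k\star a', & \Gamma_{TL}(a\otimes a')&=a\circ x_j\otimes y_j\star a',\\ \Gamma_{LB}(a\otimes a')&=u_k\circ a'\otimes v_k\star a, & \Gamma_{BL}(a\otimes a')&=x_j\star a'\otimes y_j\circ a,\\ \Gamma_{RT}(a\otimes a')&=a'\star u^k\otimes a\circ v^k, & \Gamma_{TR}(a\otimes a')&=a'\circ x^j\otimes a\star y^j \end{align*} are invertible, and the inverse of $\Gamma_{XY}$ is $\Gamma_{YX}$. -/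

import Mathlib

open scoped TensorProduct

/-- A double algebra over `k`: two associative unital `k`-algebra structures on the `k`-module `A`,
the vertical one `V = ⟨A, v, e⟩`, with `v a b` standing for `a ∘ b`, and the horizontal one
`H = ⟨A, h, i⟩`, with `h a b` standing for `a ⋆ b`, subject to the eight axioms A1 to A8. -/
structure DoubleAlgebra (k A : Type*) [CommRing k] [AddCommGroup A] [Module k A] where
  /-- vertical multiplication `a ∘ b` -/
  v : A →ₗ[k] A →ₗ[k] A
  /-- vertical unit -/
  e : A
  /-- horizontal multiplication `a ⋆ b` -/
  h : A →ₗ[k] A →ₗ[k] A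
  /-- horizontal unit -/
  i : A
  v_assoc : ∀ a b c, v (v a b) c = v a (v b c)
  e_v : ∀ a, v e a = a
  v_e : ∀ a, v a e = a
  h_assoc : ∀ a b c, h (h a b) c = h a (h b c)
  i_h : ∀ a, h i a = a
  h_i : ∀ a, h a i = a
  A1 : ∀ a b, v (h a e) b = h (v (h a e) i) b
  A2 : ∀ a b, v a (h b e) = h (v i (h b e)) a
  A3 : ∀ a b, h (v a i) b = v (h (v a i) e) b
  A4 : ∀ a b, h a (v b i) = v (h e (v b i)) a
  A5 : ∀ a b, v a (h e b) = h a (v i (h e b))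
  A6 : ∀ a b, v (h e a) b = h b (v (h e a) i)
  A7 : ∀ a b, h a (v i b) = v a (h e (v i b))
  A8 : ∀ a b, h (v i a) b = v b (h (v i a) e)

section BalancedTensor

variable {k A : Type*} [CommRing k] [AddCommGroup A] [Module k A]

/-- The tensor square `A ⊗_X A`, as a `k`-module, over a subalgebra `X` of the `k`-algebra `A`
with multiplication `m`: the quotient of `A ⊗[k] A` by the relations
`(a x) ⊗ a' = a ⊗ (x a')` for `x ∈ X`. -/
abbrev BalTensor (m : A →ₗ[k] A →ₗ[k] A) (X : Submodule k A) : Type _ :=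
  (A ⊗[k] A) ⧸ Submodule.span k
    {t : A ⊗[k] A | ∃ a x a' : A, x ∈ X ∧ t = m a x ⊗ₜ[k] a' - a ⊗ₜ[k] m x a'}

namespace BalTensor

variable {m : A →ₗ[k] A →ₗ[k] A} {X : Submodule k A}

/-- The element `a ⊗ a'` of `A ⊗_X A`, bilinear in `a` and `a'`. -/
def tmul (m : A →ₗ[k] A →ₗ[k] A) (X : Submodule k A) : A →ₗ[k] A →ₗ[k] BalTensor m X :=
  (TensorProduct.mk k A A).compr₂ (Submodule.mkQ _)

theorem tmul_balanced (a a' : A) {x : A} (hx : x ∈ X) :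
    tmul m X (m a x) a' = tmul m X a (m x a') := by
  refine (Submodule.Quotient.eq _).2 (Submodule.subset_span ⟨a, x, a', hx, rfl⟩)

/-- The `k`-linear map `A ⊗_X A → M` induced by an `X`-balanced bilinear map. -/
def lift {M : Type*} [AddCommGroup M] [Module k M] (f : A →ₗ[k] A →ₗ[k] M)
    (hf : ∀ a x a', x ∈ X → f (m a x) a' = f a (m x a')) : BalTensor m X →ₗ[k] M :=
  Submodule.liftQ _ (TensorProduct.lift f) (by
    rw [Submodule.span_le]
    rintro _ ⟨a, x, a', hx, rfl⟩
    simp [hf a x a' hx])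

@[simp] theorem lift_tmul {M : Type*} [AddCommGroup M] [Module k M] (f : A →ₗ[k] A →ₗ[k] M)
    (hf : ∀ a x a', x ∈ X → f (m a x) a' = f a (m x a')) (a a' : A) :
    lift f hf (tmul m X a a') = f a a' := rfl

end BalTensor

/-- Dual bases for `φ` with respect to the multiplication `m`: finitely many pairs `(x_j, y_j)` with
`∑ φ(a x_j) y_j = a = ∑ x_j φ(y_j a)` for all `a`. -/
structure DualBasis (m : A →ₗ[k] A →ₗ[k] A) (φ : A →ₗ[k] A) where
  n : ℕ
  x : Fin n → A
  y : Fin n → A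
  left : ∀ a, ∑ j, m (φ (m a (x j))) (y j) = a
  right : ∀ a, ∑ j, m (x j) (φ (m (y j) a)) = a

/-- `φ` is a Frobenius homomorphism onto the subalgebra `X` of the algebra `A` with multiplication
`m`: an `X`-`X`-bimodule map `A → X` which possesses dual bases. -/
structure IsFrobeniusHom (m : A →ₗ[k] A →ₗ[k] A) (X : Submodule k A) (φ : A →ₗ[k] A) : Prop where
  mem : ∀ a, φ a ∈ X
  map_left : ∀ a, ∀ x ∈ X, φ (m x a) = m x (φ a)
  map_right : ∀ a, ∀ x ∈ X, φ (m a x) = m (φ a) x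
  exists_dualBasis : Nonempty (DualBasis m φ)

namespace DualBasis

variable {m : A →ₗ[k] A →ₗ[k] A} {φ : A →ₗ[k] A}

/-- Centrality of the dual basis: `∑ c x_j ⊗ y_j = ∑ x_j ⊗ y_j c`, also after applying
a balanced bilinear map. -/
theorem central (d : DualBasis m φ) (hm : ∀ a b c, m (m a b) c = m a (m b c))
    {X : Submodule k A} (hX : ∀ a, φ a ∈ X) {M : Type*} [AddCommGroup M] [Module k M]
    (f : A →ₗ[k] A →ₗ[k] M) (hf : ∀ a x a', x ∈ X → f (m a x) a' = f a (m x a')) (c : A) :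
    ∑ j, f (m c (d.x j)) (d.y j) = ∑ j, f (d.x j) (m (d.y j) c) := by
  calc ∑ j, f (m c (d.x j)) (d.y j)
      = ∑ j, ∑ l, f (d.x l) (m (φ (m (m (d.y l) c) (d.x j))) (d.y j)) := by
        refine Finset.sum_congr rfl fun j _ => ?_
        conv_lhs => rw [← d.right (m c (d.x j))]
        simp only [map_sum, LinearMap.sum_apply]
        refine Finset.sum_congr rfl fun l _ => ?_
        rw [hf _ _ _ (hX _), hm]
    _ = ∑ l, f (d.x l) (m (d.y l) c) := by
        rw [Finset.sum_comm]
        refine Finset.sum_congr rfl fun l _ => ?_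
        rw [← map_sum, d.left]

/-- The value of a balanced bilinear map on the dual basis does not depend on its choice. -/
theorem sum_eq (d d' : DualBasis m φ)
    {X : Submodule k A} (hX : ∀ a, φ a ∈ X) {M : Type*} [AddCommGroup M] [Module k M]
    (f : A →ₗ[k] A →ₗ[k] M) (hf : ∀ a x a', x ∈ X → f (m a x) a' = f a (m x a')) :
    ∑ j, f (d.x j) (d.y j) = ∑ j, f (d'.x j) (d'.y j) := by
  calc ∑ j, f (d.x j) (d.y j)
      = ∑ j, ∑ l, f (d.x j) (m (φ (m (d.y j) (d'.x l))) (d'.y l)) := by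
        refine Finset.sum_congr rfl fun j _ => ?_
        rw [← map_sum, d'.left]
    _ = ∑ l, f (d'.x l) (d'.y l) := by
        rw [Finset.sum_comm]
        refine Finset.sum_congr rfl fun l _ => ?_
        conv_rhs => rw [← d.right (d'.x l)]
        simp only [map_sum, LinearMap.sum_apply]
        refine Finset.sum_congr rfl fun j _ => ?_
        rw [hf _ _ _ (hX _)]

/-- The comultiplication `Δ : A → A ⊗_X A`, `Δ(a) = ∑ a x_j ⊗ y_j`, of a Frobenius homomorphism. -/
def comul (d : DualBasis m φ) (X : Submodule k A) : A →ₗ[k] BalTensor m X :=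
  ∑ j, ((BalTensor.tmul m X).flip (d.y j)) ∘ₗ (m.flip (d.x j))

theorem comul_apply (d : DualBasis m φ) (X : Submodule k A) (a : A) :
    d.comul X a = ∑ j, BalTensor.tmul m X (m a (d.x j)) (d.y j) := by
  simp [comul]

/-- The comultiplication does not depend on the choice of the dual basis. -/
theorem comul_eq (d d' : DualBasis m φ) (hm : ∀ a b c, m (m a b) c = m a (m b c))
    {X : Submodule k A} (hX : ∀ a, φ a ∈ X) : d.comul X = d'.comul X := by
  ext a
  rw [comul_apply, comul_apply]
  exact d.sum_eq d' hX ((BalTensor.tmul m X).comp (m a)) fun b x c hx => by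
    simp only [LinearMap.comp_apply]
    rw [← hm, BalTensor.tmul_balanced _ _ hx]

end DualBasis

end BalancedTensor

namespace DoubleAlgebra

variable {k A : Type*} [CommRing k] [AddCommGroup A] [Module k A]

section Base

variable (D : DoubleAlgebra k A)

/-- `φ_L(a) = a ⋆ e` -/
def φL : A →ₗ[k] A := D.h.flip D.e
/-- `φ_R(a) = e ⋆ a` -/
def φR : A →ₗ[k] A := D.h D.e
/-- `φ_B(a) = a ∘ i` -/
def φB : A →ₗ[k] A := D.v.flip D.i
/-- `φ_T(a) = i ∘ a` -/
def φT : A →ₗ[k] A := D.v D.i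

/-- The left base algebra `L = φ_L(A)`, a subalgebra of `V`. -/
def L : Submodule k A := LinearMap.range D.φL
/-- The right base algebra `R = φ_R(A)`, a subalgebra of `V`. -/
def R : Submodule k A := LinearMap.range D.φR
/-- The bottom base algebra `B = φ_B(A)`, a subalgebra of `H`. -/
def B : Submodule k A := LinearMap.range D.φB
/-- The top base algebra `T = φ_T(A)`, a subalgebra of `H`. -/
def T : Submodule k A := LinearMap.range D.φT

theorem φL_apply (a : A) : D.φL a = D.h a D.e := rfl
theorem φR_apply (a : A) : D.φR a = D.h D.e a := rfl
theorem φB_apply (a : A) : D.φB a = D.v a D.i := rfl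
theorem φT_apply (a : A) : D.φT a = D.v D.i a := rfl

/-- `L`, `R` are unital subalgebras of `V`, and `B`, `T` are unital subalgebras of `H`. -/
theorem base_subalgebras :
    (D.e ∈ D.L ∧ ∀ x ∈ D.L, ∀ y ∈ D.L, D.v x y ∈ D.L) ∧
    (D.e ∈ D.R ∧ ∀ x ∈ D.R, ∀ y ∈ D.R, D.v x y ∈ D.R) ∧
    (D.i ∈ D.B ∧ ∀ x ∈ D.B, ∀ y ∈ D.B, D.h x y ∈ D.B) ∧
    (D.i ∈ D.T ∧ ∀ x ∈ D.T, ∀ y ∈ D.T, D.h x y ∈ D.T) := by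
  refine ⟨⟨⟨D.i, D.i_h _⟩, ?_⟩, ⟨⟨D.i, D.h_i _⟩, ?_⟩, ⟨⟨D.e, D.e_v _⟩, ?_⟩, ⟨⟨D.e, D.v_e _⟩, ?_⟩⟩
  · rintro _ ⟨a, rfl⟩ _ ⟨b, rfl⟩
    exact ⟨D.h (D.v (D.h a D.e) D.i) b, by
      simp only [φL_apply]; rw [D.A1 a (D.h b D.e), D.h_assoc]⟩
  · rintro _ ⟨a, rfl⟩ _ ⟨b, rfl⟩
    exact ⟨D.h a (D.v D.i (D.h D.e b)), by
      simp only [φR_apply]; rw [D.A5 (D.h D.e a) b, D.h_assoc]⟩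
  · rintro _ ⟨a, rfl⟩ _ ⟨b, rfl⟩
    exact ⟨D.v (D.h (D.v a D.i) D.e) b, by
      simp only [φB_apply]; rw [D.A3 a (D.v b D.i), D.v_assoc]⟩
  · rintro _ ⟨a, rfl⟩ _ ⟨b, rfl⟩
    exact ⟨D.v a (D.h D.e (D.v D.i b)), by
      simp only [φT_apply]; rw [D.A7 (D.v D.i a) b, D.v_assoc]⟩

/-- The tensor square `A ⊗_L A` over `L ⊆ V`. -/
abbrev TenL : Type _ := BalTensor D.v D.L
/-- The tensor square `A ⊗_R A` over `R ⊆ V`. -/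
abbrev TenR : Type _ := BalTensor D.v D.R
/-- The tensor square `A ⊗_B A` over `B ⊆ H`. -/
abbrev TenB : Type _ := BalTensor D.h D.B
/-- The tensor square `A ⊗_T A` over `T ⊆ H`. -/
abbrev TenT : Type _ := BalTensor D.h D.T

/-- The double algebra is Frobenius: the four base homomorphisms are Frobenius homomorphisms. -/
structure IsFrobenius : Prop where
  L : IsFrobeniusHom D.v D.L D.φL
  R : IsFrobeniusHom D.v D.R D.φR
  B : IsFrobeniusHom D.h D.B D.φB
  T : IsFrobeniusHom D.h D.T D.φT

/-- A choice of dual bases for the four base homomorphisms: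
`B = (u_k, v_k)`, `L = (x_j, y_j)`, `T = (u^k, v^k)`, `R = (x^j, y^j)`. -/
structure DualBases where
  L : DualBasis D.v D.φL
  R : DualBasis D.v D.φR
  B : DualBasis D.h D.φB
  T : DualBasis D.h D.φT

/-- The map `S` is an antipode of the double algebra. -/
structure IsAntipode (S : A →ₗ[k] A) : Prop where
  B : ∀ a a' a'', D.φB (D.h a' (D.v a'' a)) = D.φB (D.h (D.v a' (S a)) a'')
  R : ∀ a a' a'', D.φR (D.v a' (D.h a a'')) = D.φR (D.v (D.h (S a) a') a'')
  L : ∀ a a' a'', D.φL (D.v (D.h a' a) a'') = D.φL (D.v a' (D.h a'' (S a)))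
  T : ∀ a a' a'', D.φT (D.h (D.v a a') a'') = D.φT (D.h a' (D.v (S a) a''))

end Base

section Actions

/-! The action of an element of a base algebra through either multiplication: for each corner,
an action of `x ∈ X` on one side in one algebra is an action of an element of a neighbouring base
algebra in the other algebra. -/

variable (D : DoubleAlgebra k A)

theorem L_v {l : A} (hl : l ∈ D.L) (a : A) : D.v l a = D.h (D.φB l) a := by
  obtain ⟨b, rfl⟩ := hl; exact D.A1 b a
theorem v_L {l : A} (hl : l ∈ D.L) (a : A) : D.v a l = D.h (D.φT l) a := by
  obtain ⟨b, rfl⟩ := hl; exact D.A2 a b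
theorem B_h {b : A} (hb : b ∈ D.B) (a : A) : D.h b a = D.v (D.φL b) a := by
  obtain ⟨c, rfl⟩ := hb; exact D.A3 c a
theorem h_B {b : A} (hb : b ∈ D.B) (a : A) : D.h a b = D.v (D.φR b) a := by
  obtain ⟨c, rfl⟩ := hb; exact D.A4 a c
theorem v_R {r : A} (hr : r ∈ D.R) (a : A) : D.v a r = D.h a (D.φT r) := by
  obtain ⟨b, rfl⟩ := hr; exact D.A5 a b
theorem R_v {r : A} (hr : r ∈ D.R) (a : A) : D.v r a = D.h a (D.φB r) := by
  obtain ⟨b, rfl⟩ := hr; exact D.A6 b a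
theorem h_T {t : A} (ht : t ∈ D.T) (a : A) : D.h a t = D.v a (D.φR t) := by
  obtain ⟨b, rfl⟩ := ht; exact D.A7 a b
theorem T_h {t : A} (ht : t ∈ D.T) (a : A) : D.h t a = D.v a (D.φL t) := by
  obtain ⟨b, rfl⟩ := ht; exact D.A8 b a

theorem φL_mem (a : A) : D.φL a ∈ D.L := ⟨a, rfl⟩
theorem φR_mem (a : A) : D.φR a ∈ D.R := ⟨a, rfl⟩
theorem φB_mem (a : A) : D.φB a ∈ D.B := ⟨a, rfl⟩
theorem φT_mem (a : A) : D.φT a ∈ D.T := ⟨a, rfl⟩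

end Actions

section Distributive

variable (D : DoubleAlgebra k A)

/-- `A ⊗_B A → A`, `x ⊗ y ↦ (x ∘ a') ⋆ (y ∘ a'')`. -/
def evB (a' a'' : A) : D.TenB →ₗ[k] A :=
  BalTensor.lift (D.h.compl₁₂ (D.v.flip a') (D.v.flip a'')) (by
    intro a x c hx
    simp only [LinearMap.compl₁₂_apply, LinearMap.flip_apply]
    rw [D.h_B hx, D.v_assoc, ← D.h_B hx, D.h_assoc, D.B_h hx (D.v c a''), D.B_h hx c, D.v_assoc])

/-- `A ⊗_L A → A`, `x ⊗ y ↦ (x ⋆ a') ∘ (y ⋆ a'')`. -/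
def evL (a' a'' : A) : D.TenL →ₗ[k] A :=
  BalTensor.lift (D.v.compl₁₂ (D.h.flip a') (D.h.flip a'')) (by
    intro a x c hx
    simp only [LinearMap.compl₁₂_apply, LinearMap.flip_apply]
    rw [D.v_L hx, D.h_assoc, ← D.v_L hx, D.v_assoc, D.L_v hx (D.h c a''), D.L_v hx c, D.h_assoc])

/-- `A ⊗_T A → A`, `x ⊗ y ↦ (a' ∘ x) ⋆ (a'' ∘ y)`. -/
def evT (a' a'' : A) : D.TenT →ₗ[k] A :=
  BalTensor.lift (D.h.compl₁₂ (D.v a') (D.v a'')) (by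
    intro a x c hx
    simp only [LinearMap.compl₁₂_apply]
    rw [D.h_T hx, ← D.v_assoc, ← D.h_T hx, D.h_assoc, D.T_h hx (D.v a'' c), D.T_h hx c, D.v_assoc])

/-- `A ⊗_R A → A`, `x ⊗ y ↦ (a' ⋆ x) ∘ (a'' ⋆ y)`. -/
def evR (a' a'' : A) : D.TenR →ₗ[k] A :=
  BalTensor.lift (D.v.compl₁₂ (D.h a') (D.h a'')) (by
    intro a x c hx
    simp only [LinearMap.compl₁₂_apply]
    rw [D.v_R hx, ← D.h_assoc, ← D.v_R hx, D.v_assoc, D.R_v hx (D.h a'' c), D.R_v hx c, D.h_assoc])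

variable {D} in
/-- The four distributive laws, written with the comultiplications computed from the dual bases `F`:
`a_(1) ⊗ a_(2) = Δ_B(a)`, `a_[1] ⊗ a_[2] = Δ_L(a)`, `a^(1) ⊗ a^(2) = Δ_T(a)`,
`a^[1] ⊗ a^[2] = Δ_R(a)`. -/
structure DualBases.DistributiveLaws (F : D.DualBases) : Prop where
  B : ∀ a a' a'', D.v a (D.h a' a'') = D.evB a' a'' (F.B.comul D.B a)
  L : ∀ a a' a'', D.h a (D.v a' a'') = D.evL a' a'' (F.L.comul D.L a)
  T : ∀ a a' a'', D.v (D.h a' a'') a = D.evT a' a'' (F.T.comul D.T a)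
  R : ∀ a a' a'', D.h (D.v a' a'') a = D.evR a' a'' (F.R.comul D.R a)

/-- A distributive Frobenius double algebra. The choice of dual bases is immaterial, see
`isDistributive_iff`. -/
structure IsDistributive : Prop where
  frobenius : D.IsFrobenius
  laws : ∀ F : D.DualBases, F.DistributiveLaws

/-- It is the same to require the distributive laws for one choice of dual bases. -/
theorem isDistributive_iff (F : D.DualBases) :
    D.IsDistributive ↔ D.IsFrobenius ∧ F.DistributiveLaws := by
  refine ⟨fun H => ⟨H.frobenius, H.laws F⟩, fun H => ⟨H.1, fun G => ?_⟩⟩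
  have hB := G.B.comul_eq F.B D.h_assoc D.φB_mem
  have hL := G.L.comul_eq F.L D.v_assoc D.φL_mem
  have hT := G.T.comul_eq F.T D.h_assoc D.φT_mem
  have hR := G.R.comul_eq F.R D.v_assoc D.φR_mem
  exact ⟨by rw [hB]; exact H.2.B, by rw [hL]; exact H.2.L, by rw [hT]; exact H.2.T,
    by rw [hR]; exact H.2.R⟩

end Distributive

namespace DualBases

/-! The eight Galois maps. -/

variable {D : DoubleAlgebra k A} (F : D.DualBases)

/-- `Γ_RB(a ⊗_R a') = ∑ (a ⋆ u_k) ⊗_B (v_k ∘ a')` -/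
def ΓRB : D.TenR →ₗ[k] D.TenB :=
  BalTensor.lift (∑ j, (BalTensor.tmul D.h D.B).compl₁₂ (D.h.flip (F.B.x j)) (D.v (F.B.y j))) (by
    intro a r a' hr
    have key := F.B.central D.h_assoc D.φB_mem
      ((BalTensor.tmul D.h D.B).compl₁₂ (D.h a) (D.v.flip a')) (fun x b y hb => by
        simp only [LinearMap.compl₁₂_apply, LinearMap.flip_apply]
        rw [← D.h_assoc, BalTensor.tmul_balanced _ _ hb, D.B_h hb y, D.v_assoc, ← D.B_h hb])
      (D.φT r)
    simp only [LinearMap.sum_apply, LinearMap.compl₁₂_apply, LinearMap.flip_apply] at key ⊢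
    simp only [D.v_R hr, D.h_assoc, key, ← D.v_assoc])

/-- `Γ_BR(a ⊗_B a') = ∑ (a ⋆ x^j) ⊗_R (y^j ∘ a')` -/
def ΓBR : D.TenB →ₗ[k] D.TenR :=
  BalTensor.lift (∑ j, (BalTensor.tmul D.v D.R).compl₁₂ (D.h.flip (F.R.x j)) (D.v (F.R.y j))) (by
    intro a b a' hb
    have key := F.R.central D.v_assoc D.φR_mem
      ((BalTensor.tmul D.v D.R).compl₁₂ (D.h a) (D.v.flip a')) (fun x r y hr => by
        simp only [LinearMap.compl₁₂_apply, LinearMap.flip_apply]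
        rw [D.v_R hr x, ← D.h_assoc, ← D.v_R hr, BalTensor.tmul_balanced _ _ hr, D.v_assoc])
      (D.φL b)
    simp only [LinearMap.sum_apply, LinearMap.compl₁₂_apply, LinearMap.flip_apply] at key ⊢
    simp only [D.B_h hb, D.h_assoc, key, ← D.v_assoc])

/-- `Γ_LT(a ⊗_L a') = ∑ (a ∘ u^k) ⊗_T (v^k ⋆ a')` -/
def ΓLT : D.TenL →ₗ[k] D.TenT :=
  BalTensor.lift (∑ j, (BalTensor.tmul D.h D.T).compl₁₂ (D.v.flip (F.T.x j)) (D.h (F.T.y j))) (by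
    intro a l a' hl
    have key := F.T.central D.h_assoc D.φT_mem
      ((BalTensor.tmul D.h D.T).compl₁₂ (D.v a) (D.h.flip a')) (fun x t y ht => by
        simp only [LinearMap.compl₁₂_apply, LinearMap.flip_apply]
        rw [D.h_T ht x, ← D.v_assoc, ← D.h_T ht, BalTensor.tmul_balanced _ _ ht, D.h_assoc])
      (D.φB l)
    simp only [LinearMap.sum_apply, LinearMap.compl₁₂_apply, LinearMap.flip_apply] at key ⊢
    simp only [D.L_v hl, D.v_assoc, key, ← D.h_assoc])

/-- `Γ_TL(a ⊗_T a') = ∑ (a ∘ x_j) ⊗_L (y_j ⋆ a')` -/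
def ΓTL : D.TenT →ₗ[k] D.TenL :=
  BalTensor.lift (∑ j, (BalTensor.tmul D.v D.L).compl₁₂ (D.v.flip (F.L.x j)) (D.h (F.L.y j))) (by
    intro a t a' ht
    have key := F.L.central D.v_assoc D.φL_mem
      ((BalTensor.tmul D.v D.L).compl₁₂ (D.v a) (D.h.flip a')) (fun x l y hl => by
        simp only [LinearMap.compl₁₂_apply, LinearMap.flip_apply]
        rw [← D.v_assoc, BalTensor.tmul_balanced _ _ hl, D.L_v hl y, D.h_assoc, ← D.L_v hl])
      (D.φR t)
    simp only [LinearMap.sum_apply, LinearMap.compl₁₂_apply, LinearMap.flip_apply] at key ⊢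
    simp only [D.h_T ht, D.v_assoc, key, ← D.h_assoc])

/-- `Γ_LB(a ⊗_L a') = ∑ (u_k ∘ a') ⊗_B (v_k ⋆ a)` -/
def ΓLB : D.TenL →ₗ[k] D.TenB :=
  BalTensor.lift
    (∑ j, ((BalTensor.tmul D.h D.B).compl₁₂ (D.v (F.B.x j)) (D.h (F.B.y j))).flip) (by
    intro a l a' hl
    have key := F.B.central D.h_assoc D.φB_mem
      ((BalTensor.tmul D.h D.B).compl₁₂ (D.v.flip a') (D.h.flip a)) (fun x b y hb => by
        simp only [LinearMap.compl₁₂_apply, LinearMap.flip_apply]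
        rw [D.h_B hb x, D.v_assoc, ← D.h_B hb, BalTensor.tmul_balanced _ _ hb, D.h_assoc])
      (D.φT l)
    simp only [LinearMap.sum_apply, LinearMap.compl₁₂_apply, LinearMap.flip_apply] at key ⊢
    simp only [D.v_L hl, ← D.h_assoc, ← key, ← D.v_assoc])

/-- `Γ_BL(a ⊗_B a') = ∑ (x_j ⋆ a') ⊗_L (y_j ∘ a)` -/
def ΓBL : D.TenB →ₗ[k] D.TenL :=
  BalTensor.lift
    (∑ j, ((BalTensor.tmul D.v D.L).compl₁₂ (D.h (F.L.x j)) (D.v (F.L.y j))).flip) (by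
    intro a b a' hb
    have key := F.L.central D.v_assoc D.φL_mem
      ((BalTensor.tmul D.v D.L).compl₁₂ (D.h.flip a') (D.v.flip a)) (fun x l y hl => by
        simp only [LinearMap.compl₁₂_apply, LinearMap.flip_apply]
        rw [D.v_L hl x, D.h_assoc, ← D.v_L hl, BalTensor.tmul_balanced _ _ hl, D.v_assoc])
      (D.φR b)
    simp only [LinearMap.sum_apply, LinearMap.compl₁₂_apply, LinearMap.flip_apply] at key ⊢
    simp only [D.h_B hb, ← D.v_assoc, ← key, ← D.h_assoc])

/-- `Γ_RT(a ⊗_R a') = ∑ (a' ⋆ u^k) ⊗_T (a ∘ v^k)` -/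
def ΓRT : D.TenR →ₗ[k] D.TenT :=
  BalTensor.lift
    (∑ j, ((BalTensor.tmul D.h D.T).compl₁₂ (D.h.flip (F.T.x j)) (D.v.flip (F.T.y j))).flip) (by
    intro a r a' hr
    have key := F.T.central D.h_assoc D.φT_mem
      ((BalTensor.tmul D.h D.T).compl₁₂ (D.h a') (D.v a)) (fun x t y ht => by
        simp only [LinearMap.compl₁₂_apply]
        rw [← D.h_assoc, BalTensor.tmul_balanced _ _ ht, D.T_h ht y, ← D.v_assoc, ← D.T_h ht])
      (D.φB r)
    simp only [LinearMap.sum_apply, LinearMap.compl₁₂_apply, LinearMap.flip_apply] at key ⊢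
    simp only [D.v_assoc, D.R_v hr, D.h_assoc, key])

/-- `Γ_TR(a ⊗_T a') = ∑ (a' ∘ x^j) ⊗_R (a ⋆ y^j)` -/
def ΓTR : D.TenT →ₗ[k] D.TenR :=
  BalTensor.lift
    (∑ j, ((BalTensor.tmul D.v D.R).compl₁₂ (D.v.flip (F.R.x j)) (D.h.flip (F.R.y j))).flip) (by
    intro a t a' ht
    have key := F.R.central D.v_assoc D.φR_mem
      ((BalTensor.tmul D.v D.R).compl₁₂ (D.v a') (D.h a)) (fun x r y hr => by
        simp only [LinearMap.compl₁₂_apply]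
        rw [← D.v_assoc, BalTensor.tmul_balanced _ _ hr, D.R_v hr y, ← D.h_assoc, ← D.R_v hr])
      (D.φL t)
    simp only [LinearMap.sum_apply, LinearMap.compl₁₂_apply, LinearMap.flip_apply] at key ⊢
    simp only [D.h_assoc, D.T_h ht, D.v_assoc, key])

theorem ΓRB_tmul (a a' : A) : F.ΓRB (BalTensor.tmul D.v D.R a a') =
    ∑ j, BalTensor.tmul D.h D.B (D.h a (F.B.x j)) (D.v (F.B.y j) a') := by
  simp [ΓRB]

theorem ΓBR_tmul (a a' : A) : F.ΓBR (BalTensor.tmul D.h D.B a a') =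
    ∑ j, BalTensor.tmul D.v D.R (D.h a (F.R.x j)) (D.v (F.R.y j) a') := by
  simp [ΓBR]

theorem ΓLT_tmul (a a' : A) : F.ΓLT (BalTensor.tmul D.v D.L a a') =
    ∑ j, BalTensor.tmul D.h D.T (D.v a (F.T.x j)) (D.h (F.T.y j) a') := by
  simp [ΓLT]

theorem ΓTL_tmul (a a' : A) : F.ΓTL (BalTensor.tmul D.h D.T a a') =
    ∑ j, BalTensor.tmul D.v D.L (D.v a (F.L.x j)) (D.h (F.L.y j) a') := by
  simp [ΓTL]

theorem ΓLB_tmul (a a' : A) : F.ΓLB (BalTensor.tmul D.v D.L a a') =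
    ∑ j, BalTensor.tmul D.h D.B (D.v (F.B.x j) a') (D.h (F.B.y j) a) := by
  simp [ΓLB]

theorem ΓBL_tmul (a a' : A) : F.ΓBL (BalTensor.tmul D.h D.B a a') =
    ∑ j, BalTensor.tmul D.v D.L (D.h (F.L.x j) a') (D.v (F.L.y j) a) := by
  simp [ΓBL]

theorem ΓRT_tmul (a a' : A) : F.ΓRT (BalTensor.tmul D.v D.R a a') =
    ∑ j, BalTensor.tmul D.h D.T (D.h a' (F.T.x j)) (D.v a (F.T.y j)) := by
  simp [ΓRT]

theorem ΓTR_tmul (a a' : A) : F.ΓTR (BalTensor.tmul D.h D.T a a') =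
    ∑ j, BalTensor.tmul D.v D.R (D.v a' (F.R.x j)) (D.h a (F.R.y j)) := by
  simp [ΓTR]

end DualBases

end DoubleAlgebra

/-! An element of a base algebra acts on one side through `∘` exactly as an element of a
neighbouring base algebra acts through `⋆`. A factor φ_X(...) can therefore be moved past either
multiplication, and dual basis sums can be collapsed inside mixed products. Galois maps: dual bases
make the pairings x ⊗ y ↦ x φ_X(y c) and x ⊗ y ↦ φ_X(c x) y separate the points of A ⊗_X A. Paired
in this way, a composite of two opposite Galois maps loses its outer dual basis; the sum over the
inner one is a distributive law evaluated at units, such as ∑ u_k ⋆ (v_k ∘ c) = φ_T(φ_R(c)), and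
this returns the original pairing. Antipode: combined with the full distributive laws, invertibility
gives exchange formulas (`h_v_exchange` and its three analogues). These reduce each antipode
identity to the case where one argument is a unit. S is defined so that the unit case for φ_B holds,
and each full identity then yields the unit case of the next, in the order B, L, T, R. -/

namespace BalTensor

variable {k A : Type*} [CommRing k] [AddCommGroup A] [Module k A]
  {m : A →ₗ[k] A →ₗ[k] A} {X : Submodule k A}

theorem hom_ext {M : Type*} [AddCommGroup M] [Module k M] {f g : BalTensor m X →ₗ[k] M}
    (h : ∀ a a', f (tmul m X a a') = g (tmul m X a a')) : f = g := by
  apply Submodule.linearMap_qext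
  apply TensorProduct.ext'
  exact h

end BalTensor

/-! ### Pairings on A ⊗_X A from a Frobenius homomorphism. -/

namespace IsFrobeniusHom

variable {k A : Type*} [CommRing k] [AddCommGroup A] [Module k A]
  {m : A →ₗ[k] A →ₗ[k] A} {X : Submodule k A} {φ : A →ₗ[k] A}

/-- `x ⊗ y ↦ x φ(y c)` -/
def pairRight (hφ : IsFrobeniusHom m X φ) (hm : ∀ a b c, m (m a b) c = m a (m b c)) (c : A) :
    BalTensor m X →ₗ[k] A :=
  BalTensor.lift (m.compl₂ (φ ∘ₗ m.flip c)) (by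
    intro a x a' hx
    simp only [LinearMap.compl₂_apply, LinearMap.comp_apply, LinearMap.flip_apply]
    rw [hm x, hφ.map_left _ _ hx, hm])

/-- `x ⊗ y ↦ φ(c x) y` -/
def pairLeft (hφ : IsFrobeniusHom m X φ) (hm : ∀ a b c, m (m a b) c = m a (m b c)) (c : A) :
    BalTensor m X →ₗ[k] A :=
  BalTensor.lift (m ∘ₗ φ ∘ₗ m c) (by
    intro a x a' hx
    simp only [LinearMap.comp_apply]
    rw [← hm c, hφ.map_right _ _ hx, hm])

variable (hφ : IsFrobeniusHom m X φ) (hm : ∀ a b c, m (m a b) c = m a (m b c))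

@[simp] theorem pairRight_tmul (c x y : A) :
    hφ.pairRight hm c (BalTensor.tmul m X x y) = m x (φ (m y c)) := rfl

@[simp] theorem pairLeft_tmul (c x y : A) :
    hφ.pairLeft hm c (BalTensor.tmul m X x y) = m (φ (m c x)) y := rfl

/-- The values of φ lie in X, so they cross the tensor sign, and the dual basis identity then
applies in the second leg. -/
theorem sum_pairRight (d : DualBasis m φ) (t : BalTensor m X) :
    ∑ j, BalTensor.tmul m X (hφ.pairRight hm (d.x j) t) (d.y j) = t := by
  suffices h : ∑ j, (BalTensor.tmul m X).flip (d.y j) ∘ₗ hφ.pairRight hm (d.x j) =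
      LinearMap.id by simpa using LinearMap.congr_fun h t
  refine BalTensor.hom_ext fun a a' => ?_
  simp only [LinearMap.sum_apply, LinearMap.comp_apply, LinearMap.flip_apply, pairRight_tmul,
    LinearMap.id_apply]
  simp only [BalTensor.tmul_balanced _ _ (hφ.mem _), ← map_sum, d.left]

theorem sum_pairLeft (d : DualBasis m φ) (t : BalTensor m X) :
    ∑ j, BalTensor.tmul m X (d.x j) (hφ.pairLeft hm (d.y j) t) = t := by
  suffices h : ∑ j, BalTensor.tmul m X (d.x j) ∘ₗ hφ.pairLeft hm (d.y j) =
      LinearMap.id by simpa using LinearMap.congr_fun h t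
  refine BalTensor.hom_ext fun a a' => ?_
  simp only [LinearMap.sum_apply, LinearMap.comp_apply, pairLeft_tmul, LinearMap.id_apply]
  simp only [← BalTensor.tmul_balanced _ _ (hφ.mem _)]
  rw [← LinearMap.sum_apply, ← map_sum, d.right]

/-- `sum_pairRight` rebuilds a tensor from its pairings. This turns equalities in the quotient A ⊗_X
A into equalities in A. -/
theorem ext_pairRight {t t' : BalTensor m X}
    (h : ∀ c, hφ.pairRight hm c t = hφ.pairRight hm c t') : t = t' := by
  obtain ⟨d⟩ := hφ.exists_dualBasis
  rw [← hφ.sum_pairRight hm d t, ← hφ.sum_pairRight hm d t']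
  simp only [h]

theorem ext_pairLeft {t t' : BalTensor m X}
    (h : ∀ c, hφ.pairLeft hm c t = hφ.pairLeft hm c t') : t = t' := by
  obtain ⟨d⟩ := hφ.exists_dualBasis
  rw [← hφ.sum_pairLeft hm d t, ← hφ.sum_pairLeft hm d t']
  simp only [h]

end IsFrobeniusHom

namespace DualBasis

variable {k A : Type*} [CommRing k] [AddCommGroup A] [Module k A]
  {m : A →ₗ[k] A →ₗ[k] A} {φ : A →ₗ[k] A}

theorem comul_apply' (d : DualBasis m φ) (hm : ∀ a b c, m (m a b) c = m a (m b c))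
    {X : Submodule k A} (hX : ∀ a, φ a ∈ X) (a : A) :
    d.comul X a = ∑ j, BalTensor.tmul m X (d.x j) (m (d.y j) a) := by
  rw [comul_apply]
  exact d.central hm hX (BalTensor.tmul m X) (fun b x c hx => BalTensor.tmul_balanced b c hx) a

end DualBasis

namespace DoubleAlgebra

variable {k A : Type*} [CommRing k] [AddCommGroup A] [Module k A]

/-! ### One-sided linearity and mutual inverses among the base homomorphisms. -/

section Base

variable (D : DoubleAlgebra k A)

theorem φL_h (a b : A) : D.φL (D.h a b) = D.h a (D.φL b) := D.h_assoc _ _ _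
theorem φR_h (a b : A) : D.φR (D.h a b) = D.h (D.φR a) b := (D.h_assoc _ _ _).symm
theorem φB_v (a b : A) : D.φB (D.v a b) = D.v a (D.φB b) := D.v_assoc _ _ _
theorem φT_v (a b : A) : D.φT (D.v a b) = D.v (D.φT a) b := (D.v_assoc _ _ _).symm

/-- Both sides are the action of l on the unit e, through `⋆` and through `∘`. The next two lemmas
are similar. -/
theorem φL_φB {l : A} (hl : l ∈ D.L) : D.φL (D.φB l) = l := by
  rw [φL_apply, ← D.L_v hl, D.v_e]
theorem φR_φT {r : A} (hr : r ∈ D.R) : D.φR (D.φT r) = r := by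
  rw [φR_apply, ← D.v_R hr, D.e_v]
theorem φT_φL {t : A} (ht : t ∈ D.T) : D.φT (D.φL t) = t := by
  rw [φT_apply, ← D.T_h ht, D.h_i]

@[simp] theorem evB_tmul (a' a'' x y : A) :
    D.evB a' a'' (BalTensor.tmul D.h D.B x y) = D.h (D.v x a') (D.v y a'') := rfl
@[simp] theorem evL_tmul (a' a'' x y : A) :
    D.evL a' a'' (BalTensor.tmul D.v D.L x y) = D.v (D.h x a') (D.h y a'') := rfl
@[simp] theorem evT_tmul (a' a'' x y : A) :
    D.evT a' a'' (BalTensor.tmul D.h D.T x y) = D.h (D.v a' x) (D.v a'' y) := rfl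
@[simp] theorem evR_tmul (a' a'' x y : A) :
    D.evR a' a'' (BalTensor.tmul D.v D.R x y) = D.v (D.h a' x) (D.h a'' y) := rfl

end Base

namespace DualBases

variable {D : DoubleAlgebra k A} {F : D.DualBases}

/-! ### Distributive laws as explicit sums, and their values at units. -/

namespace DistributiveLaws

theorem v_h (H : F.DistributiveLaws) (a a' a'' : A) : D.v a (D.h a' a'') =
    ∑ j, D.h (D.v (D.h a (F.B.x j)) a') (D.v (F.B.y j) a'') := by
  rw [H.B, DualBasis.comul_apply, map_sum]; rfl

/-- Centrality of the dual basis lets a sit on the second leg, the shape in which the image of `ΓBL`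
presents it; `h_v_right` does the same for `ΓLT`. -/
theorem h_v (H : F.DistributiveLaws) (a a' a'' : A) : D.h a (D.v a' a'') =
    ∑ j, D.v (D.h (F.L.x j) a') (D.h (D.v (F.L.y j) a) a'') := by
  rw [H.L, DualBasis.comul_apply' _ D.v_assoc D.φL_mem, map_sum]; rfl

theorem h_v_right (H : F.DistributiveLaws) (a a' a'' : A) : D.v (D.h a' a'') a =
    ∑ j, D.h (D.v a' (F.T.x j)) (D.v a'' (D.h (F.T.y j) a)) := by
  rw [H.T, DualBasis.comul_apply' _ D.h_assoc D.φT_mem, map_sum]; rfl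

theorem v_h_right (H : F.DistributiveLaws) (a a' a'' : A) : D.h (D.v a' a'') a =
    ∑ j, D.v (D.h a' (D.v a (F.R.x j))) (D.h a'' (F.R.y j)) := by
  rw [H.R, DualBasis.comul_apply, map_sum]; rfl

/-- This and the next seven are distributive laws with the multiplier and one factor set to units.
Each one is what remains of a composite of Galois maps after pairing. -/
theorem φT_φR (H : F.DistributiveLaws) (c : A) :
    ∑ j, D.h (F.B.x j) (D.v (F.B.y j) c) = D.φT (D.φR c) := by
  simpa [D.v_e, D.i_h, φL_apply, φR_apply, φB_apply, φT_apply] using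
    (H.v_h D.i D.e c).symm

theorem φT_φL (H : F.DistributiveLaws) (c : A) :
    ∑ j, D.h (D.v (F.B.x j) c) (F.B.y j) = D.φT (D.φL c) := by
  simpa [D.v_e, D.i_h, φL_apply, φR_apply, φB_apply, φT_apply] using
    (H.v_h D.i c D.e).symm

theorem φR_φT (H : F.DistributiveLaws) (c : A) :
    ∑ j, D.v (F.L.x j) (D.h (F.L.y j) c) = D.φR (D.φT c) := by
  simpa [D.v_e, D.h_i, φL_apply, φR_apply, φB_apply, φT_apply] using
    (H.h_v D.e D.i c).symm

theorem φR_φB (H : F.DistributiveLaws) (c : A) :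
    ∑ j, D.v (D.h (F.L.x j) c) (F.L.y j) = D.φR (D.φB c) := by
  simpa [D.v_e, D.h_i, φL_apply, φR_apply, φB_apply, φT_apply] using
    (H.h_v D.e c D.i).symm

theorem φB_φR (H : F.DistributiveLaws) (c : A) :
    ∑ j, D.h (F.T.x j) (D.v c (F.T.y j)) = D.φB (D.φR c) := by
  simpa [D.e_v, D.h_i, φL_apply, φR_apply, φB_apply, φT_apply] using
    (H.h_v_right D.i D.e c).symm

theorem φB_φL (H : F.DistributiveLaws) (c : A) :
    ∑ j, D.h (D.v c (F.T.x j)) (F.T.y j) = D.φB (D.φL c) := by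
  simpa [D.e_v, D.h_i, φL_apply, φR_apply, φB_apply, φT_apply] using
    (H.h_v_right D.i c D.e).symm

theorem φL_φT (H : F.DistributiveLaws) (c : A) :
    ∑ j, D.v (F.R.x j) (D.h c (F.R.y j)) = D.φL (D.φT c) := by
  simpa [D.e_v, D.i_h, φL_apply, φR_apply, φB_apply, φT_apply] using
    (H.v_h_right D.e D.i c).symm

theorem φL_φB (H : F.DistributiveLaws) (c : A) :
    ∑ j, D.v (D.h c (F.R.x j)) (F.R.y j) = D.φL (D.φB c) := by
  simpa [D.e_v, D.i_h, φL_apply, φR_apply, φB_apply, φT_apply] using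
    (H.v_h_right D.e c D.i).symm

/-! ### Invertibility of the Galois maps. -/

theorem ΓBR_comp_ΓRB (H : F.DistributiveLaws) (hφ : D.IsFrobenius) :
    F.ΓBR ∘ₗ F.ΓRB = LinearMap.id := by
  -- The side of the pairing is chosen so that φ_R meets the leg where y^j is the outermost left
  -- factor, as the dual basis identity requires.
  refine BalTensor.hom_ext fun a a' => hφ.R.ext_pairRight D.v_assoc fun c => ?_
  simp only [LinearMap.comp_apply, LinearMap.id_apply, ΓRB_tmul, ΓBR_tmul, map_sum,
    IsFrobeniusHom.pairRight_tmul]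
  -- Rewriting the right R-action as a `⋆`-action frees x^j from a ⋆ u_k by associativity; turning
  -- it back afterwards exposes ∑ x^j ∘ φ_R(y^j ∘ ...).
  simp only [D.v_assoc, D.v_R (D.φR_mem _), D.h_assoc]
  simp only [← D.v_R (D.φR_mem _), ← map_sum, F.R.right, H.φT_φR]

theorem ΓRB_comp_ΓBR (H : F.DistributiveLaws) (hφ : D.IsFrobenius) :
    F.ΓRB ∘ₗ F.ΓBR = LinearMap.id := by
  refine BalTensor.hom_ext fun a a' => hφ.B.ext_pairLeft D.h_assoc fun c => ?_
  simp only [LinearMap.comp_apply, LinearMap.id_apply, ΓBR_tmul, ΓRB_tmul, map_sum,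
    IsFrobeniusHom.pairLeft_tmul]
  simp only [D.B_h (D.φB_mem _), ← D.h_assoc, ← D.v_assoc]
  simp only [← D.B_h (D.φB_mem _), ← LinearMap.sum_apply, ← map_sum, F.B.left, H.φL_φB]

theorem ΓTL_comp_ΓLT (H : F.DistributiveLaws) (hφ : D.IsFrobenius) :
    F.ΓTL ∘ₗ F.ΓLT = LinearMap.id := by
  refine BalTensor.hom_ext fun a a' => hφ.L.ext_pairLeft D.v_assoc fun c => ?_
  simp only [LinearMap.comp_apply, LinearMap.id_apply, ΓLT_tmul, ΓTL_tmul, map_sum,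
    IsFrobeniusHom.pairLeft_tmul]
  simp only [D.L_v (D.φL_mem _), ← D.v_assoc, ← D.h_assoc]
  simp only [← D.L_v (D.φL_mem _), ← LinearMap.sum_apply, ← map_sum, F.L.left, H.φB_φL]

theorem ΓLT_comp_ΓTL (H : F.DistributiveLaws) (hφ : D.IsFrobenius) :
    F.ΓLT ∘ₗ F.ΓTL = LinearMap.id := by
  refine BalTensor.hom_ext fun a a' => hφ.T.ext_pairRight D.h_assoc fun c => ?_
  simp only [LinearMap.comp_apply, LinearMap.id_apply, ΓTL_tmul, ΓLT_tmul, map_sum,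
    IsFrobeniusHom.pairRight_tmul]
  simp only [D.h_T (D.φT_mem _), D.v_assoc, D.h_assoc]
  simp only [← D.h_T (D.φT_mem _), ← map_sum, F.T.right, H.φR_φT]

theorem ΓBL_comp_ΓLB (H : F.DistributiveLaws) (hφ : D.IsFrobenius) :
    F.ΓBL ∘ₗ F.ΓLB = LinearMap.id := by
  refine BalTensor.hom_ext fun a a' => hφ.L.ext_pairRight D.v_assoc fun c => ?_
  simp only [LinearMap.comp_apply, LinearMap.id_apply, ΓLB_tmul, ΓBL_tmul, map_sum,
    IsFrobeniusHom.pairRight_tmul]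
  simp only [D.v_L (D.φL_mem _), ← D.h_assoc, D.v_assoc]
  simp only [← D.v_L (D.φL_mem _), ← LinearMap.sum_apply, ← map_sum, F.L.right, H.φT_φL]

theorem ΓLB_comp_ΓBL (H : F.DistributiveLaws) (hφ : D.IsFrobenius) :
    F.ΓLB ∘ₗ F.ΓBL = LinearMap.id := by
  refine BalTensor.hom_ext fun a a' => hφ.B.ext_pairRight D.h_assoc fun c => ?_
  simp only [LinearMap.comp_apply, LinearMap.id_apply, ΓBL_tmul, ΓLB_tmul, map_sum,
    IsFrobeniusHom.pairRight_tmul]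
  simp only [D.h_B (D.φB_mem _), ← D.v_assoc, D.h_assoc]
  simp only [← D.h_B (D.φB_mem _), ← LinearMap.sum_apply, ← map_sum, F.B.right, H.φR_φB]

theorem ΓTR_comp_ΓRT (H : F.DistributiveLaws) (hφ : D.IsFrobenius) :
    F.ΓTR ∘ₗ F.ΓRT = LinearMap.id := by
  refine BalTensor.hom_ext fun a a' => hφ.R.ext_pairLeft D.v_assoc fun c => ?_
  simp only [LinearMap.comp_apply, LinearMap.id_apply, ΓRT_tmul, ΓTR_tmul, map_sum,
    IsFrobeniusHom.pairLeft_tmul]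
  simp only [D.R_v (D.φR_mem _), D.h_assoc, ← D.v_assoc]
  simp only [← D.R_v (D.φR_mem _), ← map_sum, F.R.left, H.φB_φR]

theorem ΓRT_comp_ΓTR (H : F.DistributiveLaws) (hφ : D.IsFrobenius) :
    F.ΓRT ∘ₗ F.ΓTR = LinearMap.id := by
  refine BalTensor.hom_ext fun a a' => hφ.T.ext_pairLeft D.h_assoc fun c => ?_
  simp only [LinearMap.comp_apply, LinearMap.id_apply, ΓTR_tmul, ΓRT_tmul, map_sum,
    IsFrobeniusHom.pairLeft_tmul]
  simp only [D.T_h (D.φT_mem _), D.v_assoc, ← D.h_assoc]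
  simp only [← D.T_h (D.φT_mem _), ← map_sum, F.T.left, H.φL_φT]

/-! ### Exchange formulas. -/

theorem h_v_exchange (H : F.DistributiveLaws) (hφ : D.IsFrobenius) (a s c : A) :
    D.h (D.v a s) c = ∑ j, D.v (D.h a (F.R.x j)) (D.h s (D.v (F.R.y j) c)) := by
  -- Evaluation at (s, e) sends a ⊗ c to the left side. On the composite, the inner sum over u_k,
  -- v_k is the law `v_h` for (a ⋆ x^j) ∘ (s ⋆ (y^j ∘ c)).
  have h := congrArg (D.evB s D.e) (LinearMap.congr_fun (H.ΓRB_comp_ΓBR hφ)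
    (BalTensor.tmul D.h D.B a c))
  simpa [ΓBR_tmul, ΓRB_tmul, H.v_h, D.v_assoc, D.h_assoc, D.e_v, D.v_e, D.i_h, D.h_i]
    using h.symm

theorem v_h_exchange (H : F.DistributiveLaws) (hφ : D.IsFrobenius) (a s c : A) :
    D.v c (D.h a s) = ∑ j, D.h (D.v (F.B.x j) a) (D.v (D.h (F.B.y j) c) s) := by
  have h := congrArg (D.evL D.i s) (LinearMap.congr_fun (H.ΓBL_comp_ΓLB hφ)
    (BalTensor.tmul D.v D.L c a))
  simpa [ΓLB_tmul, ΓBL_tmul, H.h_v, D.v_assoc, D.h_assoc, D.e_v, D.v_e, D.i_h, D.h_i]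
    using h.symm

theorem v_h_exchange_right (H : F.DistributiveLaws) (hφ : D.IsFrobenius) (a s c : A) :
    D.v (D.h s a) c = ∑ j, D.h (D.v s (D.h c (F.T.x j))) (D.v a (F.T.y j)) := by
  have h := congrArg (D.evR s D.i) (LinearMap.congr_fun (H.ΓTR_comp_ΓRT hφ)
    (BalTensor.tmul D.v D.R a c))
  simpa [ΓRT_tmul, ΓTR_tmul, H.v_h_right, D.v_assoc, D.h_assoc, D.e_v, D.v_e, D.i_h, D.h_i]
    using h.symm

theorem h_v_exchange_right (H : F.DistributiveLaws) (hφ : D.IsFrobenius) (a s c : A) :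
    D.h a (D.v s c) = ∑ j, D.v (D.h (D.v a (F.L.x j)) s) (D.h (F.L.y j) c) := by
  have h := congrArg (D.evT D.e s) (LinearMap.congr_fun (H.ΓLT_comp_ΓTL hφ)
    (BalTensor.tmul D.h D.T a c))
  simpa [ΓTL_tmul, ΓLT_tmul, H.h_v_right, D.v_assoc, D.h_assoc, D.e_v, D.v_e, D.i_h, D.h_i]
    using h.symm

end DistributiveLaws

/-! ### Construction and properties of the antipode. -/

variable (F) in
/-- `S(a) = ∑ φ_B(φ_R(u_k ∘ a)) ⋆ v_k` -/
def antipode : A →ₗ[k] A :=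
  ∑ j, D.h.flip (F.B.y j) ∘ₗ D.φB ∘ₗ D.φR ∘ₗ D.v (F.B.x j)

/-- The first antipode identity at a' = e. It forces the formula for S, since S(a) = ∑ φ_B(S(a) ⋆
u_k) ⋆ v_k. -/
theorem φB_antipode_h (hφ : D.IsFrobenius) (a c : A) :
    D.φB (D.h (F.antipode a) c) = D.φB (D.φR (D.v c a)) := by
  simp only [antipode, LinearMap.sum_apply, LinearMap.comp_apply, LinearMap.flip_apply, map_sum,
    D.h_assoc]
  simp only [hφ.B.map_left _ _ (D.φB_mem _), ← hφ.B.map_right _ _ (D.φB_mem _), ← D.φR_h]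
  -- Right `⋆`-multiplication by B is a left `∘`-multiplication, so it passes inside u_k ∘ a and
  -- reaches u_k.
  simp only [D.h_B (D.φB_mem _), ← D.v_assoc]
  simp only [← D.h_B (D.φB_mem _), ← LinearMap.sum_apply, ← map_sum, F.B.right]

namespace DistributiveLaws

variable {a s : A}

/-- The exchange formula, applied with middle argument e and with s, expands both sides over the
same left factors a' ⋆ x^j. Since φ_B commutes with left `∘`-multiplication, the terms agree by the
unit case `h`. -/
theorem φB_h_v (H : F.DistributiveLaws) (hφ : D.IsFrobenius)
    (h : ∀ c, D.φB (D.h s c) = D.φB (D.φR (D.v c a))) (a' a'' : A) :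
    D.φB (D.h a' (D.v a'' a)) = D.φB (D.h (D.v a' s) a'') := by
  have h' := H.h_v_exchange hφ a' D.e (D.v a'' a)
  rw [D.v_e] at h'
  rw [h', H.h_v_exchange hφ]
  simp only [map_sum, D.φB_v, h, φR_apply, D.v_assoc]

theorem φL_v_h (H : F.DistributiveLaws) (hφ : D.IsFrobenius)
    (h : ∀ c, D.φL (D.v c s) = D.φL (D.φB (D.h c a))) (a' a'' : A) :
    D.φL (D.v (D.h a' a) a'') = D.φL (D.v a' (D.h a'' s)) := by
  have h' := H.v_h_exchange hφ a'' D.i (D.h a' a)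
  rw [D.h_i] at h'
  rw [h', H.v_h_exchange hφ]
  simp only [map_sum, D.φL_h, h, φB_apply, D.h_assoc]

theorem φT_h_v (H : F.DistributiveLaws) (hφ : D.IsFrobenius)
    (h : ∀ c, D.φT (D.h c s) = D.φT (D.φL (D.v a c))) (a' a'' : A) :
    D.φT (D.h (D.v a a') a'') = D.φT (D.h a' (D.v s a'')) := by
  have h' := H.h_v_exchange_right hφ (D.v a a') D.e a''
  rw [D.e_v] at h'
  rw [h', H.h_v_exchange_right hφ]
  simp only [map_sum, D.φT_v, h, φL_apply, D.v_assoc]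

theorem φR_v_h (H : F.DistributiveLaws) (hφ : D.IsFrobenius)
    (h : ∀ c, D.φR (D.v s c) = D.φR (D.φT (D.h a c))) (a' a'' : A) :
    D.φR (D.v a' (D.h a a'')) = D.φR (D.v (D.h s a') a'') := by
  have h' := H.v_h_exchange_right hφ a' D.i (D.h a a'')
  rw [D.i_h] at h'
  rw [h', H.v_h_exchange_right hφ]
  simp only [map_sum, D.φR_h, h, φT_apply, D.h_assoc]

theorem isAntipode (H : F.DistributiveLaws) (hφ : D.IsFrobenius) :
    D.IsAntipode F.antipode := by
  have hB a := H.φB_h_v hφ (F.φB_antipode_h hφ a)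
  -- Setting the unit in the identity just proved gives φ_B(c ⋆ a) = φ_B(φ_L(c ∘ S(a))). Applying
  -- φ_L removes φ_B on the right, leaving the unit case for φ_L. The steps to T and R repeat this.
  have hL a := H.φL_v_h hφ (a := a) (s := F.antipode a) fun c => by
    have h := congrArg D.φL (hB a c D.e)
    rwa [D.e_v, ← D.φL_apply, D.φL_φB (D.φL_mem _), eq_comm] at h
  have hT a := H.φT_h_v hφ (a := a) (s := F.antipode a) fun c => by
    have h := congrArg D.φT (hL a D.i c)
    rwa [D.i_h, ← D.φT_apply, D.φT_φL (D.φT_mem _), eq_comm] at h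
  have hR a := H.φR_v_h hφ (a := a) (s := F.antipode a) fun c => by
    have h := congrArg D.φR (hT a D.e c)
    rwa [D.v_e, ← D.φR_apply, D.φR_φT (D.φR_mem _), eq_comm] at h
  exact ⟨hB, hR, hL, hT⟩

end DistributiveLaws

end DualBases

theorem IsFrobenius.exists_dualBases {D : DoubleAlgebra k A} (hφ : D.IsFrobenius) :
    Nonempty D.DualBases := by
  obtain ⟨L⟩ := hφ.L.exists_dualBasis
  obtain ⟨R⟩ := hφ.R.exists_dualBasis
  obtain ⟨B⟩ := hφ.B.exists_dualBasis
  obtain ⟨T⟩ := hφ.T.exists_dualBasis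
  exact ⟨⟨L, R, B, T⟩⟩

end DoubleAlgebra

theorem mainTheorem3 {k A : Type*} [CommRing k] [AddCommGroup A] [Module k A]
    (D : DoubleAlgebra k A) (hD : D.IsDistributive) :
    (∃ S : A →ₗ[k] A, D.IsAntipode S) ∧
    ∀ F : D.DualBases,
      (F.ΓBR ∘ₗ F.ΓRB = LinearMap.id ∧ F.ΓRB ∘ₗ F.ΓBR = LinearMap.id) ∧
      (F.ΓTL ∘ₗ F.ΓLT = LinearMap.id ∧ F.ΓLT ∘ₗ F.ΓTL = LinearMap.id) ∧
      (F.ΓBL ∘ₗ F.ΓLB = LinearMap.id ∧ F.ΓLB ∘ₗ F.ΓBL = LinearMap.id) ∧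
      (F.ΓTR ∘ₗ F.ΓRT = LinearMap.id ∧ F.ΓRT ∘ₗ F.ΓTR = LinearMap.id) := by
  obtain ⟨hφ, H⟩ := hD
  refine ⟨?_, fun F => ?_⟩
  · obtain ⟨F⟩ := hφ.exists_dualBases
    exact ⟨F.antipode, (H F).isAntipode hφ⟩
  · exact ⟨⟨(H F).ΓBR_comp_ΓRB hφ, (H F).ΓRB_comp_ΓBR hφ⟩,
      ⟨(H F).ΓTL_comp_ΓLT hφ, (H F).ΓLT_comp_ΓTL hφ⟩,
      ⟨(H F).ΓBL_comp_ΓLB hφ, (H F).ΓLB_comp_ΓBL hφ⟩,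
      ⟨(H F).ΓTR_comp_ΓRT hφ, (H F).ΓRT_comp_ΓTR hφ⟩⟩
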